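/- Let $\mathcal Z$ be a finite set, let $\Omega=\{V\in C(\mathbf R;\mathbf R^{|\mathcal Z|}) : V(0)=0\}$ with the topology of uniform convergence on compact intervals and its Borel $\sigma$-algebra, and let $\mathbf P$ be the Wiener measure on $\Omega$ (the law of a two-sided standard Brownian motion on $\mathbf R^{|\mathcal Z|}$). Set $\theta_sV(t)=V(t+s)-V(s)$. Let $X$ be a real Hilbert space with norm $\|\cdot\|$ and Borel $\sigma$-algebra, and write $B_\delta(v)=\{w\in X:\|w-v\|<\delta\}$. A map $\phi:[0,\infty)\times X\times\Omega\to X$ is a continuous adapted cocycle if it is (jointly) continuous, $\phi_0(u,V)=u$, $\phi_{t+s}(u,V)=\phi_t(\phi_s(u,V),\theta_sV)$ for all $t,s>0$, and, for every $t>0$, $\phi_t(u,V)=\phi_t(u,\tilde V)$ whenever $V=\tilde V$ on $[0,t]$. Its transition function is $P_t(u,A)=\mathbf P(\{W\in\Omega:\phi_t(u,W)\in A\})$ for Borel sets $A\subseteq X$. A Borel probability measure $\mu$ on $X$ is invariant if $\int_X P_t(u,A)\,\mu(du)=\mu(A)$ for all $t>0$ and all Borel $A\subseteq X$. For $\alpha\in\mathbf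 R^{|\mathcal Z|}$ let $V_\alpha(s)=s\alpha$ and $\Phi^\alpha_tu=\phi_t(u,V_\alpha)$. The cocycle $\phi$ is approximately controllable if, for all $u\in X$ and $t>0$, the set of all points $\Phi^{\alpha_n}_{t_n}\cdots\Phi^{\alpha_1}_{t_1}u$ with $n\ge1$, $\alpha_j\in\mathbf R^{|\mathcal Z|}$, $t_j>0$ and $t_1+\dots+t_n=t$ is dense in $X$. Suppose that $\phi$ is an approximately controllable continuous adapted cocycle. Then: (1) $P_t(u,B_\delta(v))>0$ for all $u,v\in X$ and $\delta,t>0$; in other words, $\operatorname{supp}P_t(u,\cdot)=X$ for all $u\in X$ and $t>0$. (2) For every compact $K\subseteq X$, all $\delta,t>0$ and all $v\in X$ there is $\epsilon_0=\epsilon_0(K,\delta,t,v)>0$ such that $\inf_{u\in K}P_t(u,B_\delta(v))\ge\epsilon_0$. (3) Every invariant probability measure $\mu$ satisfies $\mu(B)>0$ for every non-empty open set $B\subseteq X$; in other words, $\operatorname{supp}\mu=X$. -/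

import Mathlib

open MeasureTheory ProbabilityTheory
open scoped NNReal ENNReal

/-- The two-sided path space `Ω`: continuous paths `V : ℝ → ℝ^Z` with `V 0 = 0`. -/
def PathSpace (Z : Type*) [Fintype Z] : Type _ :=
  {V : C(ℝ, EuclideanSpace ℝ Z) // V 0 = 0}

namespace PathSpace

variable {Z : Type*} [Fintype Z]

/-- The compact-open topology, i.e. uniform convergence on compact time intervals. -/
instance : TopologicalSpace (PathSpace Z) :=
  inferInstanceAs (TopologicalSpace {V : C(ℝ, EuclideanSpace ℝ Z) // V 0 = 0})

/-- `Ω` carries its Borel `σ`-algebra. -/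
instance : MeasurableSpace (PathSpace Z) := borel _

instance : BorelSpace (PathSpace Z) := ⟨rfl⟩

instance : CoeFun (PathSpace Z) (fun _ => ℝ → EuclideanSpace ℝ Z) := ⟨fun V => V.1⟩

/-- The shift map `(θ_s V)(t) = V(t + s) - V(s)`. -/
def shift (s : ℝ) (V : PathSpace Z) : PathSpace Z :=
  ⟨⟨fun t => V (t + s) - V s,
    (V.1.continuous.comp (continuous_add_const s)).sub continuous_const⟩, by simp⟩

/-- The linear path `V_α(s) = s α`. -/
def linear (α : EuclideanSpace ℝ Z) : PathSpace Z :=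
  ⟨⟨fun s => s • α, continuous_id.smul continuous_const⟩, by simp⟩

end PathSpace

/-- `P` is the Wiener measure on `Ω`: under `P` the evaluation process is a two-sided standard
Brownian motion on `ℝ^Z`, that is, the forward coordinate processes `t ↦ V_k(t)` and the backward
coordinate processes `t ↦ V_k(-t)`, `t ≥ 0`, `k ∈ Z`, are standard real Brownian motions, and all
of these `2|Z|` processes together are independent. -/
structure IsWienerMeasure {Z : Type*} [Fintype Z] (P : Measure (PathSpace Z)) : Prop where
  isProbabilityMeasure : IsProbabilityMeasure P
  forward : ∀ k : Z, IsBrownianReal (fun (t : ℝ≥0) (V : PathSpace Z) => V (t : ℝ) k) P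
  backward : ∀ k : Z, IsBrownianReal (fun (t : ℝ≥0) (V : PathSpace Z) => V (-(t : ℝ)) k) P
  indep : iIndepFun (fun (i : Z × Bool) (V : PathSpace Z) (t : ℝ≥0) =>
    V (if i.2 then (t : ℝ) else -(t : ℝ)) i.1) P

/-- Continuous adapted cocycles `φ : [0, ∞) × X × Ω → X`. -/
structure IsContinuousAdaptedCocycle {Z : Type*} [Fintype Z] {X : Type*} [TopologicalSpace X]
    (φ : ℝ≥0 → X → PathSpace Z → X) : Prop where
  continuous : Continuous (fun p : ℝ≥0 × X × PathSpace Z => φ p.1 p.2.1 p.2.2)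
  map_zero : ∀ (u : X) (V : PathSpace Z), φ 0 u V = u
  map_add : ∀ (u : X) (V : PathSpace Z) (t s : ℝ≥0), 0 < t → 0 < s →
    φ (t + s) u V = φ t (φ s u V) (PathSpace.shift (s : ℝ) V)
  adapted : ∀ (t : ℝ≥0) (u : X) (V V' : PathSpace Z), 0 < t →
    (∀ s ∈ Set.Icc (0 : ℝ) t, V s = V' s) → φ t u V = φ t u V'

/-- The accessibility set `A_F(u, t)` of a collection `F` of global evolutions `(t, u) ↦ Φ_t u`:
all points `Φⁿ_{tₙ} ⋯ Φ¹_{t₁} u` with `Φʲ ∈ F`, `tⱼ > 0` and `t₁ + ⋯ + tₙ = t`. The list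
`l = [(Φ¹, t₁), …, (Φⁿ, tₙ)]` is in order of application. -/
def accessibleSet {X : Type*} (F : Set (ℝ≥0 → X → X)) (u : X) (t : ℝ≥0) : Set X :=
  {w | ∃ l : List ((ℝ≥0 → X → X) × ℝ≥0),
    (∀ p ∈ l, p.1 ∈ F ∧ 0 < p.2) ∧ (l.map Prod.snd).sum = t ∧
      l.foldl (fun x p => p.1 p.2 x) u = w}

/-- The collection `F` is approximately controllable on `X`: every accessibility set at a positive
time is dense. -/
def ApproxControllableFamily {X : Type*} [TopologicalSpace X] (F : Set (ℝ≥0 → X → X)) : Prop :=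
  ∀ (u : X) (t : ℝ≥0), 0 < t → closure (accessibleSet F u t) = Set.univ

/-- The semigroups `(t, u) ↦ φ_t(u, V_α)`, `α ∈ ℝ^Z`, obtained by driving `φ` with the linear paths
`V_α(s) = s α`. -/
def cocycleSemigroups {Z : Type*} [Fintype Z] {X : Type*} (φ : ℝ≥0 → X → PathSpace Z → X) :
    Set (ℝ≥0 → X → X) :=
  {Φ | ∃ α : EuclideanSpace ℝ Z, Φ = fun t u => φ t u (PathSpace.linear α)}

/-- The cocycle `φ` is approximately controllable. -/
def ApproxControllable {Z : Type*} [Fintype Z] {X : Type*} [TopologicalSpace X]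
    (φ : ℝ≥0 → X → PathSpace Z → X) : Prop :=
  ApproxControllableFamily (cocycleSemigroups φ)

/-- The transition function `P_t(u, A) = P(φ_t(u, W) ∈ A)`, as a measure in `A`. -/
noncomputable def transitionProb {Z : Type*} [Fintype Z] {X : Type*} [MeasurableSpace X]
    (P : Measure (PathSpace Z)) (φ : ℝ≥0 → X → PathSpace Z → X) (t : ℝ≥0) (u : X) : Measure X :=
  P.map (φ t u)

/-- `μ` is an invariant (probability) measure: `μ P_t = μ` for all `t > 0`. -/
structure IsInvariantMeasure {Z : Type*} [Fintype Z] {X : Type*} [MeasurableSpace X]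
    (P : Measure (PathSpace Z)) (φ : ℝ≥0 → X → PathSpace Z → X) (μ : Measure X) : Prop where
  isProbabilityMeasure : IsProbabilityMeasure μ
  invariant : ∀ t : ℝ≥0, 0 < t → ∀ A : Set X, MeasurableSet A →
    ∫⁻ u, transitionProb P φ t u A ∂μ = μ A

/-!
Everything rests on one fact about the Wiener measure: concatenations of finitely many linear
segments lie in its support, when paths are compared uniformly on `[0, t]`
(`InWienerSupport.measure_tube_pos`). A control sequence steering `u` into an open set `B` amounts to
driving the cocycle with one such path (`IsContinuousAdaptedCocycle.exists_foldl_eq`). Since `φ_t` is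
jointly continuous and sees the path on `[0, t]` only, nearby Brownian paths and nearby initial
points also end up in `B`, so that `P_t(·, B)` is bounded below by a positive constant near `u`. The
three assertions follow: positivity directly, the uniform bound by compactness, and the claim on
invariant measures because one of countably many open sets on which `P_t(·, B)` is bounded below has
positive `μ`-measure.

The support property is obtained without the Girsanov formula. By independence of the coordinates
the problem is one-dimensional. Some tube around some path is charged, since `C([0, T])` is
separable; the difference of two independent Brownian motions in that tube is small, and divided by
`√2` it is again a Brownian motion, so every tube around the zero path is charged
(`isSupportPath_zero`). Next, a Brownian motion is the sum of `B_τ · min(s, τ) / τ` and a residual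
independent of `B_τ` (`IsPreBrownianReal.indepFun_residual`). As `B_τ` charges every interval, the
support is stable under adding multiples of `s ↦ min(s, τ)` (`IsSupportPath.add_min`), and these
functions generate all continuous piecewise linear paths which start from zero.
-/

/-! ### Brownian motion charges tubes around piecewise linear paths -/

section Tube

variable {Ω : Type*} {mΩ : MeasurableSpace Ω} {P : Measure Ω} {X Y : ℝ≥0 → Ω → ℝ}

/-- The closed tube of radius `ε` around `f`, controlled only at the times in `S`. Countable sets
`S` are used below, so that tubes are measurable for the product `σ`-algebra. -/
def tube (S : Set ℝ≥0) (f : ℝ≥0 → ℝ) (ε : ℝ) : Set (ℝ≥0 → ℝ) :=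
  {x | ∀ s ∈ S, |x s - f s| ≤ ε}

lemma measurableSet_tube {S : Set ℝ≥0} (hS : S.Countable) (f : ℝ≥0 → ℝ) (ε : ℝ) :
    MeasurableSet (tube S f ε) := by
  have : tube S f ε = ⋂ s ∈ S, {x | |x s - f s| ≤ ε} := by ext; simp [tube]
  rw [this]
  exact .biInter hS fun s _ ↦ measurableSet_le (by fun_prop) (by fun_prop)

/-- The path `f` is in the support of the law of the process `X`: on bounded time sets, `X` follows
`f` up to any prescribed error with positive probability. -/
def IsSupportPath (X : ℝ≥0 → Ω → ℝ) (P : Measure Ω) (f : ℝ≥0 → ℝ) : Prop :=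
  ∀ S : Set ℝ≥0, S.Countable → BddAbove S → ∀ ε : ℝ, 0 < ε →
    0 < P {ω | (X · ω) ∈ tube S f ε}

/-- Two pre-Brownian motions, possibly on different spaces, have the same law on path space. -/
lemma ProbabilityTheory.IsPreBrownianReal.measure_eq {Ω' : Type*}
    {mΩ' : MeasurableSpace Ω'} {Q : Measure Ω'} {Y : ℝ≥0 → Ω' → ℝ} (hX : IsPreBrownianReal X P) (hY : IsPreBrownianReal Y Q)
    (mX : ∀ t, Measurable (X t)) (mY : ∀ t, Measurable (Y t))
    {A : Set (ℝ≥0 → ℝ)} (hA : MeasurableSet A) :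
    P {ω | (X · ω) ∈ A} = Q {ω | (Y · ω) ∈ A} := by
  have m1 : Measurable (fun ω ↦ (X · ω)) := measurable_pi_lambda _ mX
  have m2 : Measurable (fun ω ↦ (Y · ω)) := measurable_pi_lambda _ mY
  have h1 : IsProjectiveLimit (P.map (fun ω ↦ (X · ω))) BrownianReal.projectiveFamily := by
    intro I
    rw [← (hX.hasLaw I).map_eq]
    exact isProjectiveLimit_map m1.aemeasurable I
  have h2 : IsProjectiveLimit (Q.map (fun ω ↦ (Y · ω))) BrownianReal.projectiveFamily := by
    intro I
    rw [← (hY.hasLaw I).map_eq]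
    exact isProjectiveLimit_map m2.aemeasurable I
  have := congrArg (fun ν ↦ ν A) (h1.unique h2)
  simp only [Measure.map_apply m1 hA, Measure.map_apply m2 hA] at this
  exact this

/-- The normalised difference of two independent pre-Brownian motions is a pre-Brownian motion. -/
lemma ProbabilityTheory.IsPreBrownianReal.sub_of_indepFun
    (hX : IsPreBrownianReal X P) (hY : IsPreBrownianReal Y P)
    (h : IndepFun (fun ω ↦ (X · ω)) (fun ω ↦ (Y · ω)) P) :
    IsPreBrownianReal (fun t ω ↦ (√2)⁻¹ * (X t ω - Y t ω)) P := by
  have := hX.isGaussianProcess.isProbabilityMeasure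
  have lX t := (hX.isGaussianProcess.hasGaussianLaw_eval t).memLp_two
  have lY t := (hY.isGaussianProcess.hasGaussianLaw_eval t).memLp_two
  have hI (s t : ℝ≥0) : IndepFun (X s) (Y t) P :=
    h.comp (measurable_pi_apply s) (measurable_pi_apply t)
  refine IsGaussianProcess.isPreBrownianReal_of_covariance ⟨fun I ↦ ?_⟩ (fun t ↦ ?_)
    fun s t hst ↦ ?_
  · have hIndep : IndepFun (fun ω ↦ I.restrict (X · ω)) (fun ω ↦ I.restrict (Y · ω)) P :=
      h.comp (Finset.measurable_restrict I) (Finset.measurable_restrict I)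
    have := (hIndep.hasGaussianLaw (hX.isGaussianProcess.hasGaussianLaw I)
      (hY.isGaussianProcess.hasGaussianLaw I)).sub.smul (√2)⁻¹
    exact this
  · rw [integral_const_mul, integral_sub (hX.integrable_eval t) (hY.integrable_eval t),
      hX.integral_eval, hY.integral_eval]
    simp
  · rw [covariance_const_mul_left, covariance_const_mul_right,
      covariance_fun_sub_fun_sub (lX s) (lY s) (lX t) (lY t),
      hX.covariance_fun_eval, hY.covariance_fun_eval, (hI s t).covariance_eq_zero (lX s) (lY t),
      (hI t s).symm.covariance_eq_zero (lY s) (lX t), min_eq_left hst]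
    have : (√2)⁻¹ * (√2)⁻¹ = (2 : ℝ)⁻¹ := by rw [← mul_inv, Real.mul_self_sqrt (by norm_num)]
    rw [← mul_assoc, this]
    ring

/-- By separability of `C([0, T])`, some tube of any given radius is charged. -/
lemma exists_measure_tube_pos [IsProbabilityMeasure P] (hX : ∀ᵐ ω ∂P, Continuous (X · ω))
    {S : Set ℝ≥0} (hS : BddAbove S) {ε : ℝ} (hε : 0 < ε) :
    ∃ g, 0 < P {ω | (X · ω) ∈ tube S g ε} := by
  obtain ⟨T, hT⟩ := hS
  let g (n : ℕ) (s : ℝ≥0) : ℝ :=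
    TopologicalSpace.denseSeq C(Set.Icc 0 T, ℝ) n (Set.projIcc 0 T zero_le s)
  by_contra! hcon
  have h0 : P (⋃ n, {ω | (X · ω) ∈ tube S (g n) ε}) = 0 :=
    measure_iUnion_null fun n ↦ le_antisymm (hcon _) zero_le
  have h1 : (⋃ n, {ω | (X · ω) ∈ tube S (g n) ε}) ∈ ae P := by
    filter_upwards [hX] with ω hω
    let x : C(Set.Icc 0 T, ℝ) := ⟨fun s ↦ X s ω, hω.comp continuous_subtype_val⟩
    obtain ⟨n, hn⟩ := (TopologicalSpace.denseRange_denseSeq C(Set.Icc 0 T, ℝ)).exists_dist_lt x hε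
    refine Set.mem_iUnion.2 ⟨n, fun s hs ↦ ?_⟩
    have h2 : Set.projIcc 0 T zero_le s = ⟨s, zero_le, hT hs⟩ := Set.projIcc_of_mem _ _
    have h3 := (ContinuousMap.dist_apply_le_dist (f := x)
      (g := TopologicalSpace.denseSeq C(Set.Icc 0 T, ℝ) n) ⟨s, zero_le, hT hs⟩).trans hn.le
    simp only [Real.dist_eq] at h3
    simp only [g, h2]
    exact h3
  have h2 : P Set.univ = 0 := by
    rw [← Set.union_compl_self (⋃ n, {ω | (X · ω) ∈ tube S (g n) ε})]
    exact measure_union_null h0 h1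
  simp at h2

/-- Small ball positivity: the zero path is in the support of Brownian motion. The difference of
two independent copies, each close to a common path `g`, is close to zero, and it is a Brownian
motion up to the factor `√2`. -/
lemma isSupportPath_zero (hX : IsBrownianReal X P) (mX : ∀ t, Measurable (X t)) :
    IsSupportPath X P 0 := by
  have := hX.isGaussianProcess.isProbabilityMeasure
  intro S hS hb ε hε
  obtain ⟨g, hg⟩ := exists_measure_tube_pos (ε := ε / 2) hX.cont hb (by positivity)
  have hlaw := (measurePreserving_fst (μ := P) (ν := P)).hasLaw
  have hlaw' := (measurePreserving_snd (μ := P) (ν := P)).hasLaw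
  have h1 : IsPreBrownianReal (fun t (ω : Ω × Ω) ↦ X t ω.1) (P.prod P) :=
    ⟨fun I ↦ (hX.hasLaw I).comp hlaw⟩
  have h2 : IsPreBrownianReal (fun t (ω : Ω × Ω) ↦ X t ω.2) (P.prod P) :=
    ⟨fun I ↦ (hX.hasLaw I).comp hlaw'⟩
  have mP : Measurable (fun ω ↦ (X · ω)) := measurable_pi_lambda _ mX
  have h3 := h1.sub_of_indepFun h2 (indepFun_prod mP mP)
  rw [hX.measure_eq h3 mX (fun t ↦ by fun_prop) (measurableSet_tube hS 0 ε)]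
  have h4 : 0 < (P.prod P) ({ω | (X · ω) ∈ tube S g (ε / 2)} ×ˢ
      {ω | (X · ω) ∈ tube S g (ε / 2)}) := by
    rw [Measure.prod_prod]
    exact ENNReal.mul_pos hg.ne' hg.ne'
  refine h4.trans_le (measure_mono ?_)
  rintro ⟨a, b⟩ ⟨ha, hb⟩ s hs
  have ha := abs_le.1 (ha s hs)
  have hb := abs_le.1 (hb s hs)
  have h5 : |X s a - X s b| ≤ ε := abs_le.2 ⟨by linarith, by linarith⟩
  have h6 : (√2)⁻¹ ≤ 1 := inv_le_one_of_one_le₀ (Real.one_le_sqrt.2 (by norm_num))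
  simp only [Pi.zero_apply, sub_zero, abs_mul]
  rw [abs_of_nonneg (by positivity)]
  exact (mul_le_of_le_one_left (abs_nonneg _) h6).trans h5

/-- The residual of a pre-Brownian motion after regression on its value at time `τ` is independent
of that value. -/
lemma ProbabilityTheory.IsPreBrownianReal.indepFun_residual (hX : IsPreBrownianReal X P)
    {τ : ℝ≥0} (hτ : 0 < τ) :
    IndepFun (fun ω (s : ℝ≥0) ↦ X s ω - (min s τ / τ : ℝ≥0) * X τ ω) (X τ) P := by
  have := hX.isGaussianProcess.isProbabilityMeasure
  have lX t := (hX.isGaussianProcess.hasGaussianLaw_eval t).memLp_two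
  have key : IndepFun (fun ω (s : ℝ≥0) ↦ X s ω - (min s τ / τ : ℝ≥0) * X τ ω)
      (fun ω (_ : Unit) ↦ X τ ω) P := by
    refine IsGaussianProcess.indepFun_of_covariance_eq_zero
      (X := fun s ω ↦ X s ω - (min s τ / τ : ℝ≥0) * X τ ω) (Y := fun _ ↦ X τ) ?_
      (fun s ↦ (hX.aemeasurable s).sub ((hX.aemeasurable τ).const_mul _))
      (fun _ ↦ hX.aemeasurable τ) fun s _ ↦ ?_
    · apply hX.isGaussianProcess.of_isGaussianProcess
      rintro (s | _)
      · exact ⟨{s, τ}, .proj ⟨s, by simp⟩ - (min s τ / τ : ℝ≥0) • .proj ⟨τ, by simp⟩,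
          fun ω ↦ by simp [NNReal.smul_def]⟩
      · exact ⟨{τ}, .proj ⟨τ, by simp⟩, fun ω ↦ by simp⟩
    · rw [covariance_fun_sub_left (lX s) ((lX τ).const_mul _) (lX τ),
        covariance_const_mul_left, hX.covariance_eval, hX.covariance_eval, min_self]
      have : (τ : ℝ) ≠ 0 := by positivity
      push_cast
      field_simp
      simp
  exact key.comp measurable_id (measurable_pi_apply ())

/-- A nondegenerate centred Gaussian variable charges every interval. -/
lemma ProbabilityTheory.IsPreBrownianReal.measure_abs_sub_le_pos (hX : IsPreBrownianReal X P)
    {τ : ℝ≥0} (hτ : 0 < τ) (a : ℝ) {ε : ℝ} (hε : 0 < ε) : 0 < P {ω | |X τ ω - a| ≤ ε} := by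
  have h1 : P {ω | |X τ ω - a| ≤ ε} = gaussianReal 0 τ (Metric.closedBall a ε) := by
    rw [← (hX.hasLaw_eval τ).map_eq, Measure.map_apply_of_aemeasurable (hX.aemeasurable τ)
      Metric.isClosed_closedBall.measurableSet]
    rfl
  rw [h1, pos_iff_ne_zero]
  intro h0
  have := gaussianReal_absolutelyContinuous' 0 hτ.ne' h0
  exact (Metric.measure_closedBall_pos volume a hε).ne' this

/-- The support of Brownian motion is stable under translation by the multiples of
`s ↦ min s τ`. Conditionally on the value at time `τ`, the path is a fixed multiple of this function
plus an independent residual, and the value at `τ` can be moved at positive cost. -/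
lemma IsSupportPath.add_min (hX : IsPreBrownianReal X P) {f : ℝ≥0 → ℝ}
    (hf : IsSupportPath X P f) (c : ℝ) (τ : ℝ≥0) :
    IsSupportPath X P (fun s ↦ f s + c * (min s τ : ℝ≥0)) := by
  obtain rfl | hτ := eq_zero_or_pos τ
  · simpa using hf
  intro S hS hb ε hε
  obtain ⟨η, hη⟩ : ∃ η, η = ε / 3 := ⟨_, rfl⟩
  have hηpos : 0 < η := by rw [hη]; positivity
  obtain ⟨m, hm⟩ : ∃ m : ℚ, 0 < P {ω | (X · ω) ∈ tube S f η ∧ |X τ ω - m| ≤ η} := by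
    by_contra! hcon
    refine (hf S hS hb η hηpos).not_ge ((measure_mono fun ω hω ↦ ?_).trans
      (measure_iUnion_null fun m : ℚ ↦ le_antisymm (hcon m) zero_le).le)
    obtain ⟨m, hm⟩ := Rat.denseRange_cast.exists_dist_lt (X τ ω) hηpos
    exact Set.mem_iUnion.2 ⟨m, hω, hm.le⟩
  have hh (s : ℝ≥0) : |((min s τ / τ : ℝ≥0) : ℝ)| ≤ 1 := by
    rw [NNReal.abs_eq]
    exact_mod_cast div_le_one_of_le₀ (min_le_right s τ) zero_le
  have hbd (s : ℝ≥0) {y : ℝ} (hy : |y| ≤ η) : |((min s τ / τ : ℝ≥0) : ℝ) * y| ≤ η := by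
    rw [abs_mul]
    exact (mul_le_of_le_one_left (abs_nonneg _) (hh s)).trans hy
  let A := tube S (fun s ↦ f s - (min s τ / τ : ℝ≥0) * m) (2 * η)
  have h1 : 0 < P ((fun ω (s : ℝ≥0) ↦ X s ω - (min s τ / τ : ℝ≥0) * X τ ω) ⁻¹' A) := by
    refine hm.trans_le (measure_mono fun ω hω s hs ↦ ?_)
    have a1 := abs_le.1 (hω.1 s hs)
    have a2 := abs_le.1 (hbd s hω.2)
    rw [abs_le]
    constructor <;> linarith
  have h2 := hX.measure_abs_sub_le_pos hτ (m + c * τ) hηpos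
  have h3 := (hX.indepFun_residual hτ).measure_inter_preimage_eq_mul A
    (Metric.closedBall (m + c * τ) η) (measurableSet_tube hS _ _)
    Metric.isClosed_closedBall.measurableSet
  refine (h3 ▸ ENNReal.mul_pos h1.ne' h2.ne').trans_le (measure_mono ?_)
  rintro ω ⟨hω1, hω2⟩ s hs
  have a1 := abs_le.1 (hω1 s hs)
  have a2 := abs_le.1 (hbd s (y := X τ ω - (m + c * τ)) hω2)
  have a3 : ((min s τ / τ : ℝ≥0) : ℝ) * (c * τ) = c * (min s τ : ℝ≥0) := by
    have : (τ : ℝ) ≠ 0 := by positivity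
    rw [NNReal.coe_div]
    field_simp
  rw [abs_le]
  constructor <;> linarith

end Tube

/-! ### The support of the Wiener measure -/

section WienerSupport

variable {Z : Type*} [Fintype Z] {P : Measure (PathSpace Z)}

lemma PathSpace.continuous_eval (s : ℝ) : Continuous fun V : PathSpace Z ↦ V s :=
  (ContinuousEvalConst.continuous_eval_const s).comp continuous_subtype_val

lemma PathSpace.measurable_coord (s : ℝ) (k : Z) : Measurable fun V : PathSpace Z ↦ V s k :=
  ((EuclideanSpace.proj k : EuclideanSpace ℝ Z →L[ℝ] ℝ).continuous.comp
    (PathSpace.continuous_eval s)).measurable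

/-- Every coordinate of `f`, restricted to nonnegative times, is in the support of the law of the
corresponding coordinate process. -/
def InWienerSupport (P : Measure (PathSpace Z)) (f : PathSpace Z) : Prop :=
  ∀ k : Z, IsSupportPath (fun (t : ℝ≥0) (V : PathSpace Z) ↦ V t k) P (fun t ↦ f t k)

/-- Independence of the coordinates turns the one-dimensional statements into the positivity of
uniform tubes in `ℝ^Z`. -/
lemma InWienerSupport.measure_tube_pos (hP : IsWienerMeasure P) {f : PathSpace Z}
    (hf : InWienerSupport P f) (T : ℝ≥0) {ε : ℝ} (hε : 0 < ε) :
    0 < P {V | ∀ s ∈ Set.Icc (0 : ℝ) T, ‖V s - f s‖ ≤ ε} := by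
  set K : ℝ≥0 := (Fintype.card Z : ℝ≥0) ^ (1 / (2 : ℝ≥0∞)).toReal
  set η : ℝ := ε / (K + 1) with hη
  have hηpos : 0 < η := by positivity
  -- Countably many times, dense in `[0, T]`, control a continuous path on `[0, T]`.
  set q : ℕ → ℝ≥0 := TopologicalSpace.denseSeq ℝ≥0
  set S : Set ℝ≥0 := Set.range fun n ↦ min (q n) T
  have hSc : S.Countable := Set.countable_range _
  have hSb : BddAbove S := ⟨T, by rintro _ ⟨n, rfl⟩; exact min_le_right _ _⟩
  have hind := hP.indep.precomp (g := fun k : Z ↦ (k, true)) (fun a b h ↦ by simpa using h)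
  have h1 := hind.measure_inter_preimage_eq_mul Finset.univ
    (sets := fun k ↦ tube S (fun t ↦ f t k) η) fun k _ ↦ measurableSet_tube hSc _ _
  have h2 : 0 < ∏ k : Z, P ((fun (V : PathSpace Z) (t : ℝ≥0) ↦ V (t : ℝ) k) ⁻¹'
      tube S (fun t ↦ f t k) η) := by
    rw [pos_iff_ne_zero, Finset.prod_ne_zero_iff]
    exact fun k _ ↦ (hf k S hSc hSb η hηpos).ne'
  simp only [if_true] at h1
  rw [← h1] at h2
  refine h2.trans_le (measure_mono fun V hV ↦ ?_)
  have h3 (k : Z) (s : ℝ≥0) : |V (min s T : ℝ≥0) k - f (min s T : ℝ≥0) k| ≤ η := by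
    have hc : IsClosed {s : ℝ≥0 | |V (min s T : ℝ≥0) k - f (min s T : ℝ≥0) k| ≤ η} := by
      have c (W : PathSpace Z) : Continuous fun s : ℝ≥0 ↦ W (min s T : ℝ≥0) k :=
        (EuclideanSpace.proj k : EuclideanSpace ℝ Z →L[ℝ] ℝ).continuous.comp
          (W.1.continuous.comp (by fun_prop))
      exact isClosed_le ((c V).sub (c f)).abs continuous_const
    have hd : closure (Set.range q) ⊆ _ := hc.closure_subset_iff.2 (by
      rintro _ ⟨n, rfl⟩
      exact Set.mem_iInter₂.1 hV k (Finset.mem_univ k) _ ⟨n, rfl⟩)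
    exact hd ((TopologicalSpace.denseRange_denseSeq ℝ≥0) s)
  intro s hs
  lift s to ℝ≥0 using hs.1
  have h4 := (PiLp.antilipschitzWith_ofLp 2 (fun _ : Z ↦ ℝ)).le_mul_dist (V s) (f s)
  have h5 : dist (V s).ofLp (f s).ofLp ≤ η := by
    refine (dist_pi_le_iff hηpos.le).2 fun k ↦ ?_
    have h6 := h3 k s
    rwa [min_eq_left (NNReal.coe_le_coe.1 hs.2)] at h6
  rw [← dist_eq_norm]
  calc dist (V s) (f s) ≤ K * dist (V s).ofLp (f s).ofLp := h4
    _ ≤ (K + 1) * η := by gcongr; linarith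
    _ = ε := by rw [hη]; field_simp

namespace PathSpace

/-- The zero path. -/
instance : Zero (PathSpace Z) := ⟨⟨0, rfl⟩⟩

@[simp] lemma zero_apply (s : ℝ) : (0 : PathSpace Z) s = 0 := rfl

/-- The path `f` with the increments of `s ↦ s • α` on `[τ, τ + h]` added. If `f` is constant on
`[τ, τ + h]`, the new path has slope `α` there. -/
def addSegment (f : PathSpace Z) (τ h : ℝ≥0) (α : EuclideanSpace ℝ Z) : PathSpace Z :=
  ⟨⟨fun s ↦ f s + (min s (τ + h) - min s τ) • α, f.1.continuous.add (by fun_prop)⟩, by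
    have h1 : (0 : ℝ) ≤ τ + h := by positivity
    simp [f.2, h1]⟩

lemma addSegment_apply (f : PathSpace Z) (τ h : ℝ≥0) (α : EuclideanSpace ℝ Z) (s : ℝ) :
    addSegment f τ h α s = f s + (min s (τ + h) - min s τ) • α := rfl

end PathSpace

lemma inWienerSupport_zero (hP : IsWienerMeasure P) : InWienerSupport P 0 := fun k ↦
  isSupportPath_zero (hP.forward k) fun t ↦ PathSpace.measurable_coord t k

lemma InWienerSupport.addSegment (hP : IsWienerMeasure P) {f : PathSpace Z}
    (hf : InWienerSupport P f) (τ h : ℝ≥0) (α : EuclideanSpace ℝ Z) :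
    InWienerSupport P (f.addSegment τ h α) := fun k ↦ by
  have h1 := ((hf k).add_min (hP.forward k).toIsPreBrownianReal (α k) (τ + h)).add_min
    (hP.forward k).toIsPreBrownianReal (-α k) τ
  convert h1 using 2 with t
  simp [PathSpace.addSegment_apply]
  ring

end WienerSupport

/-! ### Controlled paths and the transition function -/

section Cocycle

variable {Z : Type*} [Fintype Z] {X : Type*} {φ : ℝ≥0 → X → PathSpace Z → X}
  {P : Measure (PathSpace Z)}

/-- The endpoint of a control sequence is reached by driving the cocycle with the concatenation of
the corresponding segments, a single path in the support of the Wiener measure. -/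
lemma IsContinuousAdaptedCocycle.exists_foldl_eq [TopologicalSpace X]
    (hφ : IsContinuousAdaptedCocycle φ) (hP : IsWienerMeasure P)
    (l : List ((ℝ≥0 → X → X) × ℝ≥0)) (hl : ∀ p ∈ l, p.1 ∈ cocycleSemigroups φ ∧ 0 < p.2) :
    ∃ f : PathSpace Z, InWienerSupport P f ∧
      ∀ u, φ (l.map Prod.snd).sum u f = l.foldl (fun x p ↦ p.1 p.2 x) u := by
  -- The induction needs the path to stay constant after the total time.
  suffices h : ∃ f : PathSpace Z, InWienerSupport P f ∧
      (∀ s : ℝ, (l.map Prod.snd).sum ≤ s → f s = f (l.map Prod.snd).sum) ∧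
      ∀ u, φ (l.map Prod.snd).sum u f = l.foldl (fun x p ↦ p.1 p.2 x) u by
    obtain ⟨f, h1, -, h2⟩ := h
    exact ⟨f, h1, h2⟩
  induction l using List.reverseRecOn with
  | nil => exact ⟨0, inWienerSupport_zero hP, fun s _ ↦ by simp, fun u ↦ by simp [hφ.map_zero]⟩
  | append_singleton l p ih =>
    obtain ⟨f, hf, hconst, hend⟩ := ih fun p hp ↦ hl p (by simp [hp])
    obtain ⟨⟨α, hα⟩, hpos⟩ := hl p (by simp)
    set τ := (l.map Prod.snd).sum with hτ
    have hsum : ((l ++ [p]).map Prod.snd).sum = p.2 + τ := by simp [hτ, add_comm]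
    rw [hsum]
    have hτ0 : (0 : ℝ) ≤ τ := τ.2
    have hp0 : (0 : ℝ) ≤ p.2 := p.2.2
    refine ⟨f.addSegment τ p.2 α, hf.addSegment hP τ p.2 α, fun s hs ↦ ?_, fun u ↦ ?_⟩
    · push_cast at hs ⊢
      rw [PathSpace.addSegment_apply, PathSpace.addSegment_apply, hconst s (by linarith),
        hconst (p.2 + τ) (by linarith), min_eq_right (by linarith), min_eq_right (by linarith),
        min_eq_right (by linarith), min_eq_right (by linarith)]
    · have hlin : φ p.2 (l.foldl (fun x p ↦ p.1 p.2 x) u)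
          (PathSpace.shift τ (f.addSegment τ p.2 α)) =
          (l ++ [p]).foldl (fun x p ↦ p.1 p.2 x) u := by
        rw [List.foldl_append, List.foldl_cons, List.foldl_nil, hα]
        refine hφ.adapted _ _ _ _ hpos fun s hs ↦ ?_
        change (f.addSegment τ p.2 α) (s + τ) - (f.addSegment τ p.2 α) τ = s • α
        rw [PathSpace.addSegment_apply, PathSpace.addSegment_apply,
          hconst (s + τ) (by linarith [hs.1]), min_eq_left (by linarith [hs.2]),
          min_eq_right (by linarith [hs.1]), min_eq_left (by linarith), min_self]
        simp
      rw [← hlin]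
      obtain h0 | h0 := eq_zero_or_pos τ
      · have : PathSpace.shift τ (f.addSegment τ p.2 α) = f.addSegment τ p.2 α := by
          refine Subtype.ext (ContinuousMap.ext fun s ↦ ?_)
          change (f.addSegment τ p.2 α) (s + τ) - (f.addSegment τ p.2 α) τ = _
          simp [h0, (f.addSegment 0 p.2 α).2]
        rw [this, ← hend u, h0, hφ.map_zero, add_zero]
      · rw [hφ.map_add _ _ _ _ hpos h0, ← hend u]
        congr 1
        refine hφ.adapted _ _ _ _ h0 fun s hs ↦ ?_
        rw [PathSpace.addSegment_apply, min_eq_left (by linarith [hs.2]), min_eq_left hs.2]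
        simp

/-- The path on `ℝ` which extends the increments of `g` by constants outside `[0, T]`. -/
noncomputable def PathSpace.extend (T : ℝ≥0)
    (g : C(Set.Icc (0 : ℝ) T, EuclideanSpace ℝ Z)) : PathSpace Z :=
  ⟨g.comp ⟨Set.projIcc (0 : ℝ) T T.2, continuous_projIcc⟩ -
    ContinuousMap.const ℝ (g (Set.projIcc (0 : ℝ) T T.2 0)), by simp⟩

lemma PathSpace.continuous_extend (T : ℝ≥0) : Continuous (PathSpace.extend (Z := Z) T) :=
  ((ContinuousMap.continuous_precomp _).sub
    (ContinuousMap.continuous_const'.comp (ContinuousEvalConst.continuous_eval_const _))).subtype_mk _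

/-- By adaptedness, `φ_t` factors through the restriction of the path to `[0, t]`. Only nonnegative
times of the two-sided path matter, and the uniform norm on `[0, t]` controls the dependence. -/
lemma IsContinuousAdaptedCocycle.apply_extend [TopologicalSpace X]
    (hφ : IsContinuousAdaptedCocycle φ) {t : ℝ≥0} (ht : 0 < t) (u : X) (V : PathSpace Z) :
    φ t u (PathSpace.extend t (V.1.restrict (Set.Icc 0 (t : ℝ)))) = φ t u V := by
  refine hφ.adapted _ _ _ _ ht fun s hs ↦ ?_
  have h0 : (0 : ℝ) ∈ Set.Icc (0 : ℝ) t := ⟨le_rfl, t.2⟩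
  change V (Set.projIcc 0 (t : ℝ) t.2 s) - V (Set.projIcc 0 (t : ℝ) t.2 0) = V s
  have e (r : ℝ) (hr : r ∈ Set.Icc (0 : ℝ) t) : (Set.projIcc 0 (t : ℝ) t.2 r : ℝ) = r :=
    congrArg Subtype.val (Set.projIcc_of_mem _ hr)
  exact (congrArg₂ (fun a b ↦ V a - V b) (e s hs) (e 0 h0)).trans
    ((congrArg (V s - ·) V.2).trans (sub_zero _))

/-- If an open set `B` is reached from `u₀` along a path in the support of the Wiener measure, then
it is charged, uniformly for initial points near `u₀`. -/
lemma IsContinuousAdaptedCocycle.exists_le_transitionProb [TopologicalSpace X] [MeasurableSpace X]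
    [BorelSpace X] (hφ : IsContinuousAdaptedCocycle φ) (hP : IsWienerMeasure P)
    {f : PathSpace Z} (hf : InWienerSupport P f) {t : ℝ≥0} (ht : 0 < t) {B : Set X}
    (hB : IsOpen B) {u₀ : X} (hu₀ : φ t u₀ f ∈ B) :
    ∃ c : ℝ≥0∞, 0 < c ∧ ∀ᶠ u in nhds u₀, c ≤ transitionProb P φ t u B := by
  have hc : Continuous fun p : X × C(Set.Icc (0 : ℝ) t, EuclideanSpace ℝ Z) ↦
      φ t p.1 (PathSpace.extend t p.2) :=
    hφ.continuous.comp (continuous_const.prodMk (continuous_fst.prodMk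
      ((PathSpace.continuous_extend t).comp continuous_snd)))
  have hmem := hc.continuousAt.preimage_mem_nhds (x := (u₀, f.1.restrict (Set.Icc 0 (t : ℝ))))
    (hB.mem_nhds (by simpa only [hφ.apply_extend ht] using hu₀))
  obtain ⟨U, hU, W, hW, hUW⟩ := mem_nhds_prod_iff.1 hmem
  obtain ⟨ε, hε, hball⟩ := Metric.nhds_basis_closedBall.mem_iff.1 hW
  refine ⟨_, hf.measure_tube_pos hP t hε, Filter.mem_of_superset hU fun u hu ↦ ?_⟩
  have hm : Measurable (φ t u) :=
    (hφ.continuous.comp (continuous_const.prodMk (continuous_const.prodMk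
      continuous_id))).measurable
  change _ ≤ P.map (φ t u) B
  rw [Measure.map_apply hm hB.measurableSet]
  refine measure_mono fun V hV ↦ ?_
  have h1 : V.1.restrict (Set.Icc 0 (t : ℝ)) ∈ W := hball <| by
    refine (ContinuousMap.dist_le hε.le).2 fun s ↦ ?_
    rw [dist_eq_norm]
    exact hV s s.2
  have h2 : φ t u (PathSpace.extend t (V.1.restrict (Set.Icc 0 (t : ℝ)))) ∈ B :=
    hUW (Set.mk_mem_prod hu h1)
  rwa [hφ.apply_extend ht] at h2

/-- Under approximate controllability, nonempty open sets are charged by the transition function at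
every positive time, locally uniformly in the initial point. -/
lemma ApproxControllable.exists_le_transitionProb [TopologicalSpace X] [MeasurableSpace X]
    [BorelSpace X] (hctrl : ApproxControllable φ) (hφ : IsContinuousAdaptedCocycle φ)
    (hP : IsWienerMeasure P) {t : ℝ≥0} (ht : 0 < t) {B : Set X} (hB : IsOpen B)
    (hne : B.Nonempty) (u₀ : X) :
    ∃ c : ℝ≥0∞, 0 < c ∧ ∀ᶠ u in nhds u₀, c ≤ transitionProb P φ t u B := by
  obtain ⟨w, hwB, l, hl, hsum, hw⟩ :=
    (dense_iff_closure_eq.2 (hctrl u₀ t ht)).inter_open_nonempty B hB hne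
  obtain ⟨f, hf, hend⟩ := hφ.exists_foldl_eq hP l hl
  exact hφ.exists_le_transitionProb hP hf ht hB (by rwa [← hsum, hend, hw])

lemma ApproxControllable.transitionProb_pos [TopologicalSpace X] [MeasurableSpace X]
    [BorelSpace X] (hctrl : ApproxControllable φ) (hφ : IsContinuousAdaptedCocycle φ)
    (hP : IsWienerMeasure P) {t : ℝ≥0} (ht : 0 < t) {B : Set X} (hB : IsOpen B)
    (hne : B.Nonempty) (u : X) : 0 < transitionProb P φ t u B := by
  obtain ⟨c, hc, h⟩ := hctrl.exists_le_transitionProb hφ hP ht hB hne u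
  exact hc.trans_le h.self_of_nhds

lemma ApproxControllable.exists_le_iInf_transitionProb [TopologicalSpace X] [MeasurableSpace X]
    [BorelSpace X] (hctrl : ApproxControllable φ) (hφ : IsContinuousAdaptedCocycle φ)
    (hP : IsWienerMeasure P) {t : ℝ≥0} (ht : 0 < t) {B : Set X} (hB : IsOpen B)
    (hne : B.Nonempty) {K : Set X} (hK : IsCompact K) :
    ∃ ε₀ : ℝ, 0 < ε₀ ∧ ENNReal.ofReal ε₀ ≤ ⨅ u ∈ K, transitionProb P φ t u B := by
  obtain ⟨c, hc, hcK⟩ : ∃ c : ℝ≥0∞, 0 < c ∧ ∀ u ∈ K, c ≤ transitionProb P φ t u B := by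
    refine hK.induction_on
      (p := fun K ↦ ∃ c : ℝ≥0∞, 0 < c ∧ ∀ u ∈ K, c ≤ transitionProb P φ t u B)
      ⟨1, one_pos, by simp⟩ ?_ ?_ ?_
    · rintro s s' hss' ⟨c, hc, h⟩
      exact ⟨c, hc, fun u hu ↦ h u (hss' hu)⟩
    · rintro s s' ⟨c, hc, h⟩ ⟨c', hc', h'⟩
      refine ⟨min c c', lt_min hc hc', ?_⟩
      rintro u (hu | hu)
      exacts [(min_le_left _ _).trans (h u hu), (min_le_right _ _).trans (h' u hu)]
    · intro u _
      obtain ⟨c, hc, h⟩ := hctrl.exists_le_transitionProb hφ hP ht hB hne u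
      exact ⟨_, mem_nhdsWithin_of_mem_nhds h, c, hc, fun _ hv ↦ hv⟩
  refine ⟨(min c 1).toReal, ENNReal.toReal_pos (lt_min hc one_pos).ne' (by simp), ?_⟩
  rw [ENNReal.ofReal_toReal (by simp)]
  exact le_iInf₂ fun u hu ↦ (min_le_left _ _).trans (hcK u hu)

/-- Every invariant measure charges nonempty open sets. The measurability of
`u ↦ P_t(u, B)` is not needed: the interiors of the sets `{u | 1 / (n + 1) ≤ P_t(u, B)}` cover `X`,
so that one of them is charged by `μ`. -/
lemma ApproxControllable.measure_pos_of_isInvariantMeasure [TopologicalSpace X] [MeasurableSpace X]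
    [BorelSpace X] (hctrl : ApproxControllable φ) (hφ : IsContinuousAdaptedCocycle φ)
    (hP : IsWienerMeasure P) {μ : Measure X} (hμ : IsInvariantMeasure P φ μ) {B : Set X}
    (hB : IsOpen B) (hne : B.Nonempty) : 0 < μ B := by
  have := hμ.isProbabilityMeasure
  let E (n : ℕ) : Set X := interior {u | (n + 1 : ℝ≥0∞)⁻¹ ≤ transitionProb P φ 1 u B}
  have hcover : ⋃ n, E n = Set.univ := by
    refine Set.eq_univ_of_forall fun u ↦ Set.mem_iUnion.2 ?_
    obtain ⟨c, hc, h⟩ := hctrl.exists_le_transitionProb hφ hP one_pos hB hne u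
    obtain ⟨n, hn⟩ := ENNReal.exists_inv_nat_lt hc.ne'
    refine ⟨n, mem_interior_iff_mem_nhds.2 (h.mono fun v hv ↦ le_trans ?_ hv)⟩
    exact (ENNReal.inv_le_inv.2 (by simp)).trans hn.le
  obtain ⟨n, hn⟩ : ∃ n, 0 < μ (E n) := by
    by_contra! hcon
    have h0 : μ (⋃ n, E n) = 0 := measure_iUnion_null fun n ↦ le_antisymm (hcon n) zero_le
    simp [hcover] at h0
  rw [← hμ.invariant 1 one_pos B hB.measurableSet]
  calc 0 < (n + 1 : ℝ≥0∞)⁻¹ * μ (E n) :=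
        ENNReal.mul_pos (ENNReal.inv_ne_zero.2 (by finiteness)) hn.ne'
    _ = ∫⁻ _ in E n, (n + 1 : ℝ≥0∞)⁻¹ ∂μ := (setLIntegral_const _ _).symm
    _ ≤ ∫⁻ u in E n, transitionProb P φ 1 u B ∂μ :=
        setLIntegral_mono' isOpen_interior.measurableSet fun u hu ↦
          interior_subset (s := {u | (n + 1 : ℝ≥0∞)⁻¹ ≤ transitionProb P φ 1 u B}) hu
    _ ≤ ∫⁻ u, transitionProb P φ 1 u B ∂μ := setLIntegral_le_lintegral _ _

end Cocycle

theorem lemmal {Z : Type*} [Fintype Z]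
    {X : Type*} [NormedAddCommGroup X] [InnerProductSpace ℝ X] [CompleteSpace X]
    [MeasurableSpace X] [BorelSpace X]
    (P : Measure (PathSpace Z)) (hP : IsWienerMeasure P)
    (φ : ℝ≥0 → X → PathSpace Z → X) (hφ : IsContinuousAdaptedCocycle φ)
    (hctrl : ApproxControllable φ) :
    (∀ t : ℝ≥0, 0 < t → ∀ u : X,
      (∀ (v : X) (δ : ℝ), 0 < δ → 0 < transitionProb P φ t u (Metric.ball v δ)) ∧
      (transitionProb P φ t u).support = Set.univ) ∧
    (∀ K : Set X, IsCompact K → ∀ (δ : ℝ) (t : ℝ≥0) (v : X), 0 < δ → 0 < t →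
      ∃ ε₀ : ℝ, 0 < ε₀ ∧
        ENNReal.ofReal ε₀ ≤ ⨅ u ∈ K, transitionProb P φ t u (Metric.ball v δ)) ∧
    (∀ μ : Measure X, IsInvariantMeasure P φ μ →
      (∀ B : Set X, IsOpen B → B.Nonempty → 0 < μ B) ∧ μ.support = Set.univ) := by
  refine ⟨fun t ht u ↦ ⟨fun v δ hδ ↦ ?_, ?_⟩, fun K hK δ t v hδ ht ↦ ?_, fun μ hμ ↦ ⟨?_, ?_⟩⟩
  · exact hctrl.transitionProb_pos hφ hP ht Metric.isOpen_ball (Metric.nonempty_ball.2 hδ) u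
  · have : (transitionProb P φ t u).IsOpenPosMeasure :=
      ⟨fun B hB hne ↦ (hctrl.transitionProb_pos hφ hP ht hB hne u).ne'⟩
    exact Measure.support_eq_univ
  · exact hctrl.exists_le_iInf_transitionProb hφ hP ht Metric.isOpen_ball
      (Metric.nonempty_ball.2 hδ) hK
  · exact fun B hB hne ↦ hctrl.measure_pos_of_isInvariantMeasure hφ hP hμ hB hne
  · have : μ.IsOpenPosMeasure :=
      ⟨fun B hB hne ↦ (hctrl.measure_pos_of_isInvariantMeasure hφ hP hμ hB hne).ne'⟩
    exact Measure.support_eq_univ
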